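/- Let $(R,\mathfrak m)$ be a (commutative) Noetherian local ring of Krull dimension $d$. A maximal Cohen--Macaulay (MCM) $R$-module is a nonzero finitely generated $R$-module $M$ with $\operatorname{depth} M=\dim R$, and its multiplicity is $\lim_{k\to\infty} \frac{d!}{k^d}\,\operatorname{length}_R(M/\mathfrak m^kM)$. Let $M$ and $N$ be MCM $R$-modules of multiplicities $m$ and $n$ respectively, and assume that there are only finitely many isomorphism classes of MCM $R$-modules of multiplicity $m+n$. If $h$ is the number of these isomorphism classes, then $\mathfrak m^h$ annihilates $\operatorname{Ext}^1_R(M,N)$. In particular, $\operatorname{Ext}^1_R(M,N)$ has finite length. -/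

import Mathlib

open Filter Topology

universe u

namespace LocalCM

section

variable (R : Type u) [CommRing R] [IsLocalRing R]
variable (M : Type u) [AddCommGroup M] [Module R M]

/-- The depth of `M`: the supremum of the lengths of the `M`-regular sequences
contained in the maximal ideal of `R`. -/
noncomputable def depth : ℕ∞ :=
  ⨆ (rs : List R) (_ : (∀ r ∈ rs, r ∈ IsLocalRing.maximalIdeal R) ∧
    RingTheory.Sequence.IsRegular M rs), (rs.length : ℕ∞)

/-- `M` is a maximal Cohen-Macaulay `R`-module: a finitely generated nonzero module
whose depth is the Krull dimension of `R`. -/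
structure IsMCM : Prop where
  finite : Module.Finite R M
  nontrivial : Nontrivial M
  depth_eq : (depth R M : WithBot ℕ∞) = ringKrullDim R

/-- The Krull dimension of `R` as a natural number (it is finite for Noetherian local rings). -/
noncomputable def dim : ℕ := ((ringKrullDim R).unbotD 0).toNat

/-- The number `e` is the (Hilbert-Samuel) multiplicity of the `R`-module `M`: with `𝔪` the
maximal ideal and `d = dim R`, it is the limit of `d! * length (M / 𝔪 ^ k M) / k ^ d` as
`k → ∞`. For `R` Noetherian and `M` finitely generated all these lengths are finite. -/
def HasMultiplicity (e : ℝ) : Prop :=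
  Tendsto (fun k : ℕ =>
      (Nat.factorial (dim R) : ℝ) *
        ((Module.length R
          (M ⧸ (IsLocalRing.maximalIdeal R ^ k • ⊤ : Submodule R M))).toNat : ℝ) /
        (k : ℝ) ^ dim R)
    atTop (𝓝 e)

/-- The set of isomorphism classes of maximal Cohen-Macaulay `R`-modules of multiplicity `e`. -/
def mcmIsoClasses (e : ℝ) :
    Set (Quotient (CategoryTheory.isIsomorphicSetoid (ModuleCat.{u} R))) :=
  {c | ∃ K : ModuleCat.{u} R, IsMCM R K ∧ HasMultiplicity R K e ∧ Quotient.mk _ K = c}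

/-- The `R`-module `Ext¹_R(M, N)`, in the category of `R`-modules. -/
abbrev Ext1 (N : Type u) [AddCommGroup N] [Module R N] : Type u :=
  CategoryTheory.Abelian.Ext (ModuleCat.of R M) (ModuleCat.of R N) 1

end

end LocalCM

namespace LocalCM

open IsLocalRing

/-! ### Hom into modules of finite length. -/

section FiniteLength

variable {R : Type*} [CommRing R]
variable {N M X L : Type*} [AddCommGroup N] [Module R N] [Module.Finite R N]
  [AddCommGroup M] [Module R M] [Module.Finite R M] [AddCommGroup X] [Module R X]
  [AddCommGroup L] [Module R L]

/-! Choose a finite free cover `q : F → M`. Every class in Ext¹(M, N) comes from some `φ : ker q →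
N` by pushout. For `r₁, …, r_h` in the maximal ideal, the `h + 1` pushouts along `φ`, `r₁φ`,
`r₁r₂φ`, … are extensions of `M` by `N`, hence MCM (`IsMCM.of_exact`) of multiplicity `m + n`
(`HasMultiplicity.of_exact`). By pigeonhole two of them are isomorphic as modules.

So let `X_φ ≅ X_{rφ}` with `r ∈ 𝔪`. The sequence `0 → N → N × X_φ → X_{rφ} → 0` then has middle term
isomorphic to the sum of the outer ones, so it splits by Miyata's theorem
(`exists_retraction_of_equiv_prod`). Nakayama turns the splitting into an extension of `φ` to `F`
(`exists_extension_of_pushout_equiv`), which kills the class.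

Miyata's theorem is a length count for Hom into finite length modules, passed to `N` by Krull's
intersection theorem. Finite length of Ext¹ follows because it is finitely generated. -/

/-- Evaluation on finitely many generators embeds Hom into a finite power of `L`. -/
lemma isFiniteLength_linearMap (hL : IsFiniteLength R L) : IsFiniteLength R (M →ₗ[R] L) := by
  obtain ⟨t, π, hπ⟩ := Module.Finite.exists_fin' R M
  have h := isFiniteLength_iff_isNoetherian_isArtinian.mp hL
  have := h.1
  have := h.2
  have hfin : IsFiniteLength R (Fin t → L) :=
    isFiniteLength_iff_isNoetherian_isArtinian.mpr ⟨inferInstance, inferInstance⟩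
  refine IsFiniteLength.of_injective (f := LinearMap.pi fun j : Fin t =>
    LinearMap.applyₗ (R := R) (M₂ := L) (π (Pi.single j 1))) hfin fun f g hfg => ?_
  have : f ∘ₗ π = g ∘ₗ π := by
    ext j
    simpa using congrFun hfg j
  exact (LinearMap.cancel_right hπ).mp this

/-- If the middle term of a short exact sequence is isomorphic to the direct sum of the outer
terms, then maps into modules of finite length extend along the injection. -/
lemma lcomp_surjective_of_equiv_prod (i : N →ₗ[R] X) (p : X →ₗ[R] M)
    (hp : Function.Surjective p) (hip : Function.Exact i p) (e : X ≃ₗ[R] N × M)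
    (hL : IsFiniteLength R L) :
    Function.Surjective (LinearMap.lcomp R L i) := by
  have hN := isFiniteLength_iff_isNoetherian_isArtinian.mp (isFiniteLength_linearMap (M := N) hL)
  have := hN.1
  have := hN.2
  have hM : Module.length R (M →ₗ[R] L) ≠ ⊤ :=
    Module.length_ne_top_iff.mpr (isFiniteLength_linearMap hL)
  -- Left exactness of Hom, made short exact by cutting down to the range. Comparing lengths with
  -- those given by `e` forces the range to be everything.
  have hex : Function.Exact (LinearMap.lcomp R L p) (LinearMap.lcomp R L i).rangeRestrict := by
    intro f
    constructor
    · intro hf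
      have hf' : f ∘ₗ i = 0 := congrArg Subtype.val hf
      have hker : LinearMap.ker p ≤ LinearMap.ker f := by
        intro x hx
        obtain ⟨y, rfl⟩ := (hip x).mp hx
        exact LinearMap.congr_fun hf' y
      refine ⟨(LinearMap.ker p).liftQ f hker ∘ₗ (p.quotKerEquivOfSurjective hp).symm, ?_⟩
      ext x
      have : (p.quotKerEquivOfSurjective hp).symm (p x) = Submodule.Quotient.mk x :=
        (LinearEquiv.symm_apply_eq _).mpr rfl
      simp [this]
    · rintro ⟨g, rfl⟩
      refine Subtype.ext ?_
      ext y
      simp [hip.apply_apply_eq_zero]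
  have hinj : Function.Injective (LinearMap.lcomp R L p) := fun f g hfg =>
    (LinearMap.cancel_right hp).mp hfg
  have h1 := Module.length_eq_add_of_exact _ _ hinj
    (LinearMap.surjective_rangeRestrict (LinearMap.lcomp R L i)) hex
  have h2 : Module.length R (X →ₗ[R] L) =
      Module.length R (N →ₗ[R] L) + Module.length R (M →ₗ[R] L) := by
    rw [← Module.length_prod]
    exact ((LinearEquiv.congrLeft L R e).trans (LinearMap.coprodEquiv R).symm).length_eq
  rw [h2, add_comm] at h1
  rw [← LinearMap.range_eq_top]
  by_contra hne
  exact (Submodule.length_lt hne).ne (WithTop.add_left_cancel hM h1).symm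

end FiniteLength

/-! ### Miyata's theorem. -/

section Algebra

variable {R : Type*} [CommRing R] [IsLocalRing R] [IsNoetherianRing R]

/-- A finitely generated module over a Noetherian local ring that is killed by a power of the
maximal ideal has finite length. -/
lemma isFiniteLength_of_pow_smul_eq_zero {Q : Type*} [AddCommGroup Q] [Module R Q]
    [Module.Finite R Q] (k : ℕ) (hQ : ∀ r ∈ maximalIdeal R ^ k, ∀ x : Q, r • x = 0) :
    IsFiniteLength R Q := by
  -- The exponent `k + 1` keeps the quotient ring nonzero when `k = 0`.
  have hle : maximalIdeal R ^ (k + 1) ≤ maximalIdeal R :=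
    Ideal.pow_le_self k.succ_ne_zero
  have : Nontrivial (R ⧸ maximalIdeal R ^ (k + 1)) := Ideal.Quotient.nontrivial_iff.mpr
    (ne_top_of_le_ne_top (IsLocalRing.maximalIdeal.isMaximal R).ne_top hle)
  have hloc : IsLocalRing (R ⧸ maximalIdeal R ^ (k + 1)) :=
    .of_surjective' (Ideal.Quotient.mk _) Ideal.Quotient.mk_surjective
  have hart : IsArtinianRing (R ⧸ maximalIdeal R ^ (k + 1)) := by
    rw [isArtinianRing_iff_isNilpotent_maximalIdeal]
    refine ⟨k + 1, ?_⟩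
    have hmap : maximalIdeal (R ⧸ maximalIdeal R ^ (k + 1)) ≤
        (maximalIdeal R).map (Ideal.Quotient.mk _) := by
      intro x hx
      obtain ⟨y, rfl⟩ := Ideal.Quotient.mk_surjective x
      refine Ideal.mem_map_of_mem _ ?_
      rw [mem_maximalIdeal, mem_nonunits_iff] at hx ⊢
      exact fun h => hx (h.map _)
    refine le_bot_iff.mp ((Ideal.pow_right_mono hmap _).trans ?_)
    rw [← Ideal.map_pow, Ideal.map_quotient_self]
  have htors : Module.IsTorsionBySet R Q (maximalIdeal R ^ (k + 1) : Ideal R) :=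
    fun x r => hQ r (Ideal.pow_le_pow_right k.le_succ r.2) x
  let := htors.module
  have : IsScalarTower R (R ⧸ maximalIdeal R ^ (k + 1)) Q := htors.isScalarTower
  have : Module.Finite (R ⧸ maximalIdeal R ^ (k + 1)) Q := .of_restrictScalars_finite R _ _
  have : IsArtinian R Q := isArtinian_of_surjective_algebraMap
    (R := R ⧸ maximalIdeal R ^ (k + 1)) Ideal.Quotient.mk_surjective
  exact isFiniteLength_iff_isNoetherian_isArtinian.mpr ⟨inferInstance, this⟩

lemma isFiniteLength_quotient_pow_smul_top (N : Type*) [AddCommGroup N] [Module R N]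
    [Module.Finite R N] (k : ℕ) :
    IsFiniteLength R (N ⧸ (maximalIdeal R ^ k • ⊤ : Submodule R N)) := by
  refine isFiniteLength_of_pow_smul_eq_zero k fun r hr x => ?_
  obtain ⟨y, rfl⟩ := Submodule.mkQ_surjective _ x
  rw [← map_smul, Submodule.mkQ_apply, Submodule.Quotient.mk_eq_zero]
  exact Submodule.smul_mem_smul hr trivial

variable {N M X : Type*} [AddCommGroup N] [Module R N] [Module.Finite R N]
  [AddCommGroup M] [Module R M] [Module.Finite R M]
  [AddCommGroup X] [Module R X] [Module.Finite R X]

/-- A linear map from a submodule extends as soon as it extends modulo all powers of the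
maximal ideal. -/
lemma exists_extension_of_forall_pow {G : Type*} [AddCommGroup G] [Module R G]
    [Module.Finite R G] (P : Submodule R G) (θ : P →ₗ[R] N)
    (h : ∀ k : ℕ, ∃ ψ : G →ₗ[R] N, ∀ p : P,
      ψ p - θ p ∈ (maximalIdeal R ^ k • ⊤ : Submodule R N)) :
    ∃ ψ : G →ₗ[R] N, ∀ p : P, ψ p = θ p := by
  obtain ⟨s, π, hπ⟩ := Module.Finite.exists_fin' R P
  let ev : (P →ₗ[R] N) →ₗ[R] (Fin s → N) := LinearMap.pi fun j : Fin s =>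
    LinearMap.applyₗ (R := R) (M₂ := N) (π (Pi.single j 1))
  let E : Submodule R (Fin s → N) := LinearMap.range (ev ∘ₗ LinearMap.lcomp R N P.subtype)
  -- `E` records the generator values of maps that extend to `G`; Krull's intersection theorem in
  -- `N^s / E` puts `θ` among them.
  have hmem : E.mkQ (ev θ) ∈
      (⨅ k : ℕ, maximalIdeal R ^ k • ⊤ : Submodule R ((Fin s → N) ⧸ E)) := by
    rw [Submodule.mem_iInf]
    intro k
    obtain ⟨ψ, hψ⟩ := h k
    have h0 : E.mkQ (ev (ψ ∘ₗ P.subtype)) = 0 := by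
      rw [Submodule.mkQ_apply, Submodule.Quotient.mk_eq_zero]
      exact ⟨ψ, rfl⟩
    have h1 : E.mkQ (ev θ) = -E.mkQ (ev (ψ ∘ₗ P.subtype - θ)) := by
      rw [map_sub, map_sub, h0, zero_sub, neg_neg]
    rw [h1]
    refine neg_mem ?_
    have h2 : ev (ψ ∘ₗ P.subtype - θ) ∈ (maximalIdeal R ^ k • ⊤ : Submodule R (Fin s → N)) := by
      rw [← LinearMap.sum_single_apply (fun _ : Fin s => N) (ev (ψ ∘ₗ P.subtype - θ))]
      refine sum_mem fun j _ => ?_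
      have h3 := Submodule.mem_map_of_mem (f := LinearMap.single R (fun _ : Fin s => N) j)
        (hψ (π (Pi.single j 1)))
      rw [Submodule.map_smul''] at h3
      exact Submodule.smul_mono le_rfl le_top h3
    have h4 := Submodule.mem_map_of_mem (f := E.mkQ) h2
    rw [Submodule.map_smul''] at h4
    exact Submodule.smul_mono le_rfl le_top h4
  rw [Ideal.iInf_pow_smul_eq_bot_of_isLocalRing _ (IsLocalRing.maximalIdeal.isMaximal R).ne_top,
    Submodule.mem_bot, Submodule.mkQ_apply, Submodule.Quotient.mk_eq_zero] at hmem
  obtain ⟨ψ, hψ⟩ := hmem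
  refine ⟨ψ, fun p => ?_⟩
  have : (ψ ∘ₗ P.subtype) ∘ₗ π = θ ∘ₗ π := by
    ext j
    simpa [ev] using congrFun hψ j
  exact LinearMap.congr_fun ((LinearMap.cancel_right hπ).mp this) p

/-- **Miyata's theorem**: a short exact sequence of finitely generated modules whose middle term
is isomorphic to the direct sum of the outer terms splits. -/
theorem exists_retraction_of_equiv_prod (i : N →ₗ[R] X) (p : X →ₗ[R] M)
    (hi : Function.Injective i) (hp : Function.Surjective p) (hip : Function.Exact i p)
    (e : X ≃ₗ[R] N × M) : ∃ ρ : X →ₗ[R] N, ρ ∘ₗ i = LinearMap.id := by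
  obtain ⟨t, π, hπ⟩ := Module.Finite.exists_fin' R X
  -- Maps `X → N / 𝔪 ^ k N` need not lift to `N`, but their pullbacks to the free cover do; hence
  -- the retraction is sought there, as an extension of `θ = i⁻¹ ∘ π`.
  let P : Submodule R (Fin t → R) := (LinearMap.range i).comap π
  let θ : P →ₗ[R] N := (LinearEquiv.ofInjective i hi).symm.toLinearMap ∘ₗ
    (π ∘ₗ P.subtype).codRestrict (LinearMap.range i) fun x => x.2
  have hθ : ∀ x : P, i (θ x) = π x := fun x =>
    congrArg Subtype.val ((LinearEquiv.ofInjective i hi).apply_symm_apply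
      ((π ∘ₗ P.subtype).codRestrict (LinearMap.range i) (fun x => x.2) x))
  obtain ⟨ψ, hψ⟩ := exists_extension_of_forall_pow P θ fun k => by
    obtain ⟨g, hg⟩ := lcomp_surjective_of_equiv_prod i p hp hip e
      (isFiniteLength_quotient_pow_smul_top N k) (Submodule.mkQ _)
    obtain ⟨ψ, hψ⟩ := Module.projective_lifting_property
      (Submodule.mkQ (maximalIdeal R ^ k • ⊤ : Submodule R N)) (g ∘ₗ π)
      (Submodule.mkQ_surjective _)
    refine ⟨ψ, fun x => ?_⟩
    rw [← Submodule.Quotient.mk_eq_zero, ← Submodule.mkQ_apply, map_sub, sub_eq_zero,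
      ← LinearMap.comp_apply, hψ, LinearMap.comp_apply, ← hθ x]
    exact LinearMap.congr_fun hg (θ x)
  have hker : LinearMap.ker π ≤ LinearMap.ker ψ := by
    intro x hx
    have hxP : x ∈ P := by
      rw [Submodule.mem_comap, LinearMap.mem_ker.mp hx]
      exact zero_mem _
    have h0 : θ ⟨x, hxP⟩ = 0 := hi (by rw [hθ, map_zero]; exact hx)
    rw [LinearMap.mem_ker, hψ ⟨x, hxP⟩, h0]
  refine ⟨(LinearMap.ker π).liftQ ψ hker ∘ₗ (π.quotKerEquivOfSurjective hπ).symm, ?_⟩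
  ext n
  obtain ⟨x, hx⟩ := hπ (i n)
  have hxP : x ∈ P := ⟨n, hx.symm⟩
  have h1 : (π.quotKerEquivOfSurjective hπ).symm (i n) = Submodule.Quotient.mk x :=
    (LinearEquiv.symm_apply_eq _).mpr hx.symm
  have h2 : θ ⟨x, hxP⟩ = n := hi (by rw [hθ]; exact hx)
  simp [h1, hψ ⟨x, hxP⟩, h2]

end Algebra

end LocalCM

namespace LocalCM

open IsLocalRing

/-! ### Pushout extensions. -/

section Pushout

variable {R : Type*} [CommRing R]
variable {N M F : Type*} [AddCommGroup N] [Module R N] [AddCommGroup M] [Module R M]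
  [AddCommGroup F] [Module R F]
variable (q : F →ₗ[R] M) (φ : LinearMap.ker q →ₗ[R] N)

/-- The submodule of relations defining the pushout of `N ← ker q → F`. -/
def pushoutRel : Submodule R (N × F) :=
  LinearMap.range (φ.prod (-(LinearMap.ker q).subtype))

/-- The pushout of `N ← ker q → F`, which is an extension of `M` by `N` if `q` is surjective. -/
abbrev Pushout := (N × F) ⧸ pushoutRel q φ

/-- The map from `N` to the pushout. -/
def pushoutInl : N →ₗ[R] Pushout q φ := (pushoutRel q φ).mkQ ∘ₗ LinearMap.inl R N F

/-- The map from `F` to the pushout. -/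
def pushoutInr : F →ₗ[R] Pushout q φ := (pushoutRel q φ).mkQ ∘ₗ LinearMap.inr R N F

lemma mem_pushoutRel_iff (n : N) (f : F) :
    (n, f) ∈ pushoutRel q φ ↔ ∃ hf : f ∈ LinearMap.ker q, n = -φ ⟨f, hf⟩ := by
  constructor
  · rintro ⟨z, hz⟩
    obtain ⟨rfl, rfl⟩ := Prod.mk.inj hz
    refine ⟨by simp, ?_⟩
    rw [← map_neg]
    congr 1
    ext
    simp
  · rintro ⟨hf, rfl⟩
    exact ⟨-⟨f, hf⟩, by simp⟩

lemma pushoutInl_add_pushoutInr_eq_zero_iff (n : N) (f : F) :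
    pushoutInl q φ n + pushoutInr q φ f = 0 ↔ ∃ hf : f ∈ LinearMap.ker q, n = -φ ⟨f, hf⟩ := by
  rw [← mem_pushoutRel_iff, ← Submodule.Quotient.mk_eq_zero]
  simp [pushoutInl, pushoutInr, ← Submodule.Quotient.mk_add]

lemma pushoutInr_ker (z : LinearMap.ker q) : pushoutInr q φ z = pushoutInl q φ (φ z) := by
  rw [eq_comm, ← sub_eq_zero, sub_eq_add_neg, ← map_neg (pushoutInr q φ),
    pushoutInl_add_pushoutInr_eq_zero_iff]
  refine ⟨by simp, ?_⟩
  rw [← map_neg]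
  congr 1
  ext
  simp

lemma exists_pushout_rep (w : Pushout q φ) :
    ∃ n f, w = pushoutInl q φ n + pushoutInr q φ f := by
  obtain ⟨⟨n, f⟩, rfl⟩ := Submodule.mkQ_surjective _ w
  refine ⟨n, f, ?_⟩
  simp [pushoutInl, pushoutInr, ← Submodule.Quotient.mk_add]

lemma pushoutInl_injective : Function.Injective (pushoutInl q φ) := by
  rw [injective_iff_map_eq_zero]
  intro n hn
  obtain ⟨hf, h⟩ := (pushoutInl_add_pushoutInr_eq_zero_iff q φ n 0).mp (by simpa using hn)
  rw [h, neg_eq_zero]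
  exact map_zero φ

variable {K : Type*} [AddCommGroup K] [Module R K]

/-- The map out of the pushout given by a compatible pair of maps. -/
def pushoutDesc (a : N →ₗ[R] K) (b : F →ₗ[R] K) (h : ∀ z : LinearMap.ker q, b z = a (φ z)) :
    Pushout q φ →ₗ[R] K :=
  (pushoutRel q φ).liftQ (a.coprod b) (by
    rintro _ ⟨z, rfl⟩
    simp [h])

lemma pushoutDesc_inl_add_inr (a : N →ₗ[R] K) (b : F →ₗ[R] K)
    (h : ∀ z : LinearMap.ker q, b z = a (φ z)) (n : N) (f : F) :
    pushoutDesc q φ a b h (pushoutInl q φ n + pushoutInr q φ f) = a n + b f := by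
  simp [pushoutDesc, pushoutInl, pushoutInr]

/-- The projection of the pushout to `M`. -/
def pushoutProj : Pushout q φ →ₗ[R] M := pushoutDesc q φ 0 q (by simp)

lemma pushoutProj_inl_add_inr (n : N) (f : F) :
    pushoutProj q φ (pushoutInl q φ n + pushoutInr q φ f) = q f := by
  simp [pushoutProj, pushoutDesc_inl_add_inr]

lemma pushoutProj_surjective (hq : Function.Surjective q) :
    Function.Surjective (pushoutProj q φ) := fun m => by
  obtain ⟨f, rfl⟩ := hq m
  exact ⟨_, pushoutProj_inl_add_inr q φ 0 f⟩

lemma pushout_exact : Function.Exact (pushoutInl q φ) (pushoutProj q φ) := by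
  intro w
  obtain ⟨n, f, rfl⟩ := exists_pushout_rep q φ w
  rw [pushoutProj_inl_add_inr]
  constructor
  · intro hf
    refine ⟨n + φ ⟨f, hf⟩, ?_⟩
    rw [map_add, ← pushoutInr_ker]
  · rintro ⟨n', hn'⟩
    rw [← pushoutProj_inl_add_inr q φ n f, ← hn']
    simpa using pushoutProj_inl_add_inr q φ n' 0

variable [IsLocalRing R] [IsNoetherianRing R] [Module.Finite R N] [Module.Finite R F]

/-- If the pushouts along `φ` and `r • φ` are isomorphic, for some `r` in the maximal ideal, then
the extension defined by `φ` is trivial. -/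
theorem exists_extension_of_pushout_equiv {r : R} (hr : r ∈ maximalIdeal R)
    (e : Pushout q φ ≃ₗ[R] Pushout q (r • φ)) :
    ∃ ψ : F →ₗ[R] N, ∀ z : LinearMap.ker q, ψ z = φ z := by
  -- `X_{rφ}` is the pushout of `X_φ` along multiplication by `r` on `N`; this is the exact sequence
  -- of that pushout square.
  let i : N →ₗ[R] N × Pushout q φ := (r • LinearMap.id).prod (-pushoutInl q φ)
  let p : N × Pushout q φ →ₗ[R] Pushout q (r • φ) := LinearMap.coprod (pushoutInl q (r • φ))
    (pushoutDesc q φ (r • pushoutInl q (r • φ)) (pushoutInr q (r • φ))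
      (fun z => by simp [pushoutInr_ker]))
  have hp_apply : ∀ n' n f, p (n', pushoutInl q φ n + pushoutInr q φ f) =
      pushoutInl q (r • φ) (n' + r • n) + pushoutInr q (r • φ) f := by
    intro n' n f
    simp [p, pushoutDesc_inl_add_inr, add_assoc]
  have hi : Function.Injective i := fun a b hab =>
    pushoutInl_injective q φ (neg_injective (congrArg Prod.snd hab))
  have hp : Function.Surjective p := by
    intro w
    obtain ⟨n, f, rfl⟩ := exists_pushout_rep q (r • φ) w
    exact ⟨(n, pushoutInl q φ 0 + pushoutInr q φ f), by rw [hp_apply, smul_zero, add_zero]⟩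
  have hip : Function.Exact i p := by
    rintro ⟨n', w⟩
    obtain ⟨n, f, rfl⟩ := exists_pushout_rep q φ w
    rw [hp_apply, pushoutInl_add_pushoutInr_eq_zero_iff]
    constructor
    · rintro ⟨hf, h⟩
      refine ⟨-(n + φ ⟨f, hf⟩), Prod.ext ?_ ?_⟩
      · rw [LinearMap.smul_apply] at h
        have : n' = -(r • φ ⟨f, hf⟩) - r • n := eq_sub_of_add_eq h
        simp [i, this]
        abel
      · have := pushoutInr_ker q φ ⟨f, hf⟩
        simp [i, this]
    · rintro ⟨a, ha⟩
      obtain ⟨rfl, h2⟩ := Prod.mk.inj ha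
      have h3 : pushoutInl q φ (n + a) + pushoutInr q φ f = 0 := by
        rw [map_add, add_right_comm, ← h2]
        simp
      obtain ⟨hf, h⟩ := (pushoutInl_add_pushoutInr_eq_zero_iff q φ _ _).mp h3
      refine ⟨hf, ?_⟩
      change r • a + r • n = _
      rw [LinearMap.smul_apply, ← smul_neg, ← h, smul_add, add_comm]
  obtain ⟨ρ, hρ⟩ := exists_retraction_of_equiv_prod i p hi hp hip
    ((LinearEquiv.refl R N).prodCongr e)
  let b : Pushout q φ →ₗ[R] N := -(ρ ∘ₗ LinearMap.inr R _ _)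
  let a : N →ₗ[R] N := ρ ∘ₗ LinearMap.inl R _ _
  let v : N →ₗ[R] N := b ∘ₗ pushoutInl q φ
  -- The splitting reads `id = r a + v`, so `v` is onto modulo `𝔪`, hence bijective, and `v⁻¹ ∘ b`
  -- retracts `pushoutInl`.
  have hv : ∀ n, n = r • a n + v n := by
    intro n
    have h1 := LinearMap.congr_fun hρ n
    have h2 : i n = r • (n, 0) - (0, pushoutInl q φ n) := by simp [i]
    rw [LinearMap.comp_apply, h2, map_sub, map_smul, LinearMap.id_apply] at h1
    exact h1.symm.trans (by simp [a, v, b, sub_eq_add_neg])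
  have hsurj : Function.Surjective v := by
    rw [← LinearMap.range_eq_top, ← top_le_iff]
    refine Submodule.le_of_le_smul_of_le_jacobson_bot Module.Finite.fg_top
      (IsLocalRing.maximalIdeal_le_jacobson _) fun n _ => ?_
    rw [hv n, add_comm]
    exact Submodule.add_mem_sup ⟨n, rfl⟩ (Submodule.smul_mem_smul hr trivial)
  let E := LinearEquiv.ofBijective v (OrzechProperty.bijective_of_surjective_endomorphism v hsurj)
  refine ⟨E.symm.toLinearMap ∘ₗ b ∘ₗ pushoutInr q φ, fun z => ?_⟩
  rw [LinearMap.comp_apply, LinearMap.comp_apply, pushoutInr_ker]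
  exact E.symm_apply_apply (φ z)

end Pushout

end LocalCM

namespace LocalCM

open IsLocalRing CategoryTheory

/-! ### Hilbert–Samuel lengths along exact sequences. -/

section ExactSequence

variable {R N K M : Type*} [CommRing R] [AddCommGroup N] [Module R N]
  [AddCommGroup K] [Module R K] [AddCommGroup M] [Module R M]
  (i : N →ₗ[R] K) (p : K →ₗ[R] M)

/-- Reduction modulo `I` is only right exact; using the filtration induced from `K` on `N` restores
injectivity on the left. -/
lemma length_quotient_smul_top_eq_add (hp : Function.Surjective p) (hip : Function.Exact i p)
    (I : Ideal R) :
    Module.length R (K ⧸ (I • ⊤ : Submodule R K)) =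
      Module.length R (N ⧸ (I • ⊤ : Submodule R K).comap i) +
        Module.length R (M ⧸ (I • ⊤ : Submodule R M)) := by
  have hmap : (I • ⊤ : Submodule R K).map p = I • ⊤ := by
    rw [Submodule.map_smul'', Submodule.map_top, LinearMap.range_eq_top.mpr hp]
  refine Module.length_eq_add_of_exact (Submodule.mapQ _ _ i le_rfl)
    (Submodule.mapQ _ _ p (Submodule.map_le_iff_le_comap.mp hmap.le)) ?_ ?_ ?_
  · rw [injective_iff_map_eq_zero]
    intro x hx
    obtain ⟨x, rfl⟩ := Submodule.mkQ_surjective _ x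
    simpa using hx
  · intro y
    obtain ⟨y, rfl⟩ := Submodule.mkQ_surjective _ y
    obtain ⟨x, rfl⟩ := hp y
    exact ⟨Submodule.Quotient.mk x, rfl⟩
  · intro y
    obtain ⟨y, rfl⟩ := Submodule.mkQ_surjective _ y
    constructor
    · intro hy
      have h1 : p y ∈ (I • ⊤ : Submodule R M) := by simpa using hy
      rw [← hmap] at h1
      obtain ⟨z, hz, hzy⟩ := h1
      obtain ⟨x, hx⟩ := (hip (y - z)).mp (by rw [map_sub, hzy, sub_self])
      refine ⟨Submodule.Quotient.mk x, ?_⟩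
      rw [Submodule.mapQ_apply, hx, Submodule.mkQ_apply, Submodule.Quotient.eq]
      simpa using hz
    · rintro ⟨x, hx⟩
      obtain ⟨x, rfl⟩ := Submodule.mkQ_surjective _ x
      rw [← hx]
      simp [hip.apply_apply_eq_zero]

/-- Artin–Rees for the image of `i`: the induced and `I`-adic filtrations differ by a bounded shift.
-/
lemma exists_comap_pow_smul_le [IsNoetherianRing R] [Module.Finite R K] (I : Ideal R)
    (hi : Function.Injective i) :
    ∃ c : ℕ, ∀ k, (I ^ (k + c) • ⊤ : Submodule R K).comap i ≤ I ^ k • ⊤ := by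
  obtain ⟨c, hc⟩ := Ideal.exists_pow_inf_eq_pow_smul I (LinearMap.range i)
  refine ⟨c, fun k x hx => ?_⟩
  have h1 : i x ∈ I ^ (k + c) • ⊤ ⊓ LinearMap.range i := ⟨hx, x, rfl⟩
  rw [hc _ (Nat.le_add_left _ _), Nat.add_sub_cancel] at h1
  have h2 : i x ∈ I ^ k • LinearMap.range i := Submodule.smul_mono le_rfl inf_le_right h1
  rw [LinearMap.range_eq_map, ← Submodule.map_smul''] at h2
  obtain ⟨y, hy, hyx⟩ := h2
  rwa [← hi hyx]

end ExactSequence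

/-! ### Depth and multiplicity of extensions. -/

section Extension

variable {R : Type u} [CommRing R] [IsLocalRing R] [IsNoetherianRing R]
variable {N K M : Type u} [AddCommGroup N] [Module R N] [Module.Finite R N]
  [AddCommGroup M] [Module R M] [Module.Finite R M]
  [AddCommGroup K] [Module R K] [Module.Finite R K]

lemma exists_ringKrullDim_eq_natCast (R : Type u) [CommRing R] [IsLocalRing R]
    [IsNoetherianRing R] : ∃ d : ℕ, ringKrullDim R = d := by
  obtain ⟨a, ha⟩ := WithBot.ne_bot_iff_exists.mp (ringKrullDim_ne_bot (R := R))
  have ha' : a ≠ ⊤ := by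
    rintro rfl
    exact ringKrullDim_ne_top ha.symm
  obtain ⟨d, rfl⟩ := ENat.ne_top_iff_exists.mp ha'
  exact ⟨d, ha.symm⟩

/-- **Rees' theorem**: depth is detected by the vanishing of `Ext` from the residue field. -/
lemma natCast_le_depth_iff [Nontrivial M] (n : ℕ) : (n : ℕ∞) ≤ depth R M ↔
    ∀ i < n, Subsingleton (Abelian.Ext
      (ModuleCat.of R (Shrink.{u} (R ⧸ maximalIdeal R))) (ModuleCat.of R M) i) := by
  have hlt : maximalIdeal R • (⊤ : Submodule R (ModuleCat.of R M)) < ⊤ :=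
    (Submodule.top_ne_ideal_smul_of_le_jacobson_annihilator
      ((IsLocalRing.maximalIdeal_le_jacobson _))).symm.lt_top
  have tfae := fun l => ModuleCat.exists_isRegular_tfae (maximalIdeal R) l (ModuleCat.of R M) hlt
  constructor
  · intro h i hi
    have hi' : (i : ℕ∞) < depth R M := lt_of_lt_of_le (by exact_mod_cast hi) h
    simp only [depth, lt_iSup_iff] at hi'
    obtain ⟨rs, ⟨hmem, hreg⟩, hlen⟩ := hi'
    have h31 := (tfae rs.length).out 3 1
    exact h31.mp ⟨rs, rfl, hmem, hreg⟩ i (by exact_mod_cast hlen)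
  · intro h
    obtain ⟨rs, rfl, hmem, hreg⟩ := ((tfae n).out 1 3).mp h
    exact le_iSup₂_of_le rs ⟨hmem, hreg⟩ le_rfl

/-- Each member of a regular sequence lowers the support dimension by one, and the final quotient is
nonzero. -/
lemma depth_le_ringKrullDim : (depth R M : WithBot ℕ∞) ≤ ringKrullDim R := by
  obtain ⟨d, hd⟩ := exists_ringKrullDim_eq_natCast R
  rw [hd]
  refine WithBot.coe_le_coe.mpr (iSup₂_le fun rs ⟨hmem, hreg⟩ => ?_)
  have h1 := Module.supportDim_add_length_eq_supportDim_of_isRegular rs hreg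
  have h2 := Module.supportDim_le_ringKrullDim R M
  rw [hd] at h2
  have : Nontrivial (M ⧸ (Ideal.ofList rs • ⊤ : Submodule R M)) :=
    Submodule.Quotient.nontrivial_iff.mpr hreg.top_ne_smul.symm
  have : Nonempty (Module.support R (M ⧸ (Ideal.ofList rs • ⊤ : Submodule R M))) :=
    Module.nonempty_support_of_nontrivial.to_subtype
  have h3 : 0 ≤ Module.supportDim R (M ⧸ (Ideal.ofList rs • ⊤ : Submodule R M)) :=
    Order.krullDim_nonneg
  have h4 : ((rs.length : ℕ∞) : WithBot ℕ∞) ≤ ((d : ℕ∞) : WithBot ℕ∞) := by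
    refine le_trans ?_ h2
    rw [← h1]
    exact le_add_of_nonneg_left h3
  exact WithBot.coe_le_coe.mp h4

variable (i : N →ₗ[R] K) (p : K →ₗ[R] M)

/-- An extension of maximal Cohen-Macaulay modules is maximal Cohen-Macaulay. -/
theorem IsMCM.of_exact (hi : Function.Injective i) (hp : Function.Surjective p)
    (hip : Function.Exact i p) (hN : IsMCM R N) (hM : IsMCM R M) : IsMCM R K := by
  have := hN.nontrivial
  have := hM.nontrivial
  have hK : Nontrivial K := hi.nontrivial
  obtain ⟨d, hd⟩ := exists_ringKrullDim_eq_natCast R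
  refine ⟨inferInstance, hK, le_antisymm depth_le_ringKrullDim ?_⟩
  have hN' : (d : ℕ∞) ≤ depth R N := WithBot.coe_le_coe.mp (hd.symm.trans_le hN.depth_eq.ge)
  have hM' : (d : ℕ∞) ≤ depth R M := WithBot.coe_le_coe.mp (hd.symm.trans_le hM.depth_eq.ge)
  rw [hd]
  refine WithBot.coe_le_coe.mpr ?_
  rw [natCast_le_depth_iff] at hN' hM' ⊢
  intro j hj
  let S : ShortComplex (ModuleCat.{u} R) :=
    ⟨ModuleCat.ofHom i, ModuleCat.ofHom p, by ext x; exact hip.apply_apply_eq_zero x⟩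
  have hS : S.ShortExact :=
    { exact := (ShortComplex.ShortExact.moduleCat_exact_iff_function_exact _).mpr hip
      mono_f := (ModuleCat.mono_iff_injective _).mpr hi
      epi_g := (ModuleCat.epi_iff_surjective _).mpr hp }
  have h1 := hN' j hj
  have h2 := hM' j hj
  refine subsingleton_of_forall_eq 0 fun x => ?_
  obtain ⟨y, hy⟩ := Abelian.Ext.covariant_sequence_exact₂ _ hS x (h2.elim _ _)
  rw [← hy, h1.elim y 0, Abelian.Ext.zero_comp]

/-- Multiplicity is additive on short exact sequences. -/
theorem HasMultiplicity.of_exact (hi : Function.Injective i) (hp : Function.Surjective p)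
    (hip : Function.Exact i p) {m n : ℝ} (hm : HasMultiplicity R M m)
    (hn : HasMultiplicity R N n) : HasMultiplicity R K (m + n) := by
  obtain ⟨c, hc⟩ := exists_comap_pow_smul_le i (maximalIdeal R) hi
  have hfin := fun k => Module.length_ne_top_iff.mpr
    (isFiniteLength_quotient_pow_smul_top (R := R) N k)
  have hle : ∀ k, (maximalIdeal R ^ k • ⊤ : Submodule R N) ≤
      (maximalIdeal R ^ k • ⊤ : Submodule R K).comap i := fun k => by
    rw [← Submodule.map_le_iff_le_comap, Submodule.map_smul'']
    exact Submodule.smul_mono le_rfl le_top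
  let l : ℕ → ℕ∞ := fun k =>
    Module.length R (N ⧸ (maximalIdeal R ^ k • ⊤ : Submodule R K).comap i)
  have hl_le : ∀ k, l k ≤ Module.length R (N ⧸ (maximalIdeal R ^ k • ⊤ : Submodule R N)) :=
    fun k => Module.length_le_of_surjective _ (Submodule.factor_surjective (hle k))
  have hle_l : ∀ k, Module.length R (N ⧸ (maximalIdeal R ^ k • ⊤ : Submodule R N)) ≤ l (k + c) :=
    fun k => Module.length_le_of_surjective _ (Submodule.factor_surjective (hc k))
  have hl_fin : ∀ k, l k ≠ ⊤ := fun k => ne_top_of_le_ne_top (hfin k) (hl_le k)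
  have hl : Tendsto (fun k : ℕ => (Nat.factorial (dim R) : ℝ) * ((l k).toNat : ℝ) /
      (k : ℝ) ^ dim R) atTop (𝓝 n) := by
    rw [← tendsto_add_atTop_iff_nat c]
    have hratio : Tendsto (fun k : ℕ => ((k : ℝ) / ((k + c : ℕ) : ℝ)) ^ dim R) atTop (𝓝 1) := by
      have := (tendsto_natCast_div_add_atTop (c : ℝ)).pow (dim R)
      simpa using this
    have hlow := hn.mul hratio
    rw [mul_one] at hlow
    -- `l (k + c)` lies between the lengths of `N / 𝔪 ^ k N` and `N / 𝔪 ^ (k + c) N`; the factor `(k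
    -- / (k + c)) ^ d` absorbs the shift.
    refine tendsto_of_tendsto_of_tendsto_of_le_of_le' hlow
      ((tendsto_add_atTop_iff_nat c).mpr hn) ?_ (.of_forall fun k => ?_)
    · filter_upwards [eventually_gt_atTop 0] with k hk
      have hk' : ((k : ℝ)) ^ dim R ≠ 0 := pow_ne_zero _ (by exact_mod_cast hk.ne')
      rw [div_pow, div_mul_div_cancel₀ hk']
      have := ENat.toNat_le_toNat (hle_l k) (hl_fin _)
      gcongr
    · have := ENat.toNat_le_toNat (hl_le (k + c)) (hfin _)
      gcongr
  refine (hm.add hl).congr fun k => ?_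
  rw [length_quotient_smul_top_eq_add i p hp hip, ENat.toNat_add (hl_fin k)
    (Module.length_ne_top_iff.mpr (isFiniteLength_quotient_pow_smul_top M k))]
  push_cast
  ring

end Extension

end LocalCM

namespace LocalCM

open IsLocalRing CategoryTheory

/-- Induction on `h`, replacing `J` by the colon ideal `J : s`. -/
lemma pow_le_of_forall_list_prod_mem {R : Type*} [CommRing R] (I J : Ideal R) (h : ℕ)
    (H : ∀ rs : List R, rs.length = h → (∀ r ∈ rs, r ∈ I) → rs.prod ∈ J) : I ^ h ≤ J := by
  induction h generalizing J with
  | zero =>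
    rw [pow_zero, Ideal.one_eq_top, top_le_iff, Ideal.eq_top_iff_one]
    simpa using H [] rfl
  | succ h ih =>
    rw [pow_succ, Ideal.mul_le]
    intro r hr s hs
    have h1 := ih (Submodule.comap (LinearMap.mulRight R s) J) fun rs hlen hrs => by
      have := H (s :: rs) (by simp [hlen]) (by simpa [hs] using hrs)
      simpa [mul_comm] using this
    exact h1 hr

/-! ### Ext¹ classes from a presentation. -/

section Ext

variable {R : Type u} [CommRing R] {M N F : Type u} [AddCommGroup M] [Module R M]
  [AddCommGroup N] [Module R N] [AddCommGroup F] [Module R F]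
  {q : F →ₗ[R] M} (hq : Function.Surjective q)

/-- The class in `Ext¹(M, N)` of the pushout extension along `φ`. -/
noncomputable def extOfHom (φ : LinearMap.ker q →ₗ[R] N) : Ext1 R M N :=
  (LinearMap.shortExact_shortComplexKer hq).extClass.comp
    (Abelian.Ext.mk₀ (ModuleCat.ofHom φ)) (add_zero 1)

lemma extOfHom_smul (r : R) (φ : LinearMap.ker q →ₗ[R] N) :
    extOfHom hq (r • φ) = r • extOfHom hq φ := by
  rw [extOfHom, extOfHom, ← Abelian.Ext.comp_smul, ← Abelian.Ext.mk₀_smul]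
  rfl

lemma extOfHom_eq_zero (φ : LinearMap.ker q →ₗ[R] N) (ψ : F →ₗ[R] N)
    (h : ∀ z : LinearMap.ker q, ψ z = φ z) : extOfHom hq φ = 0 := by
  have hφ : ModuleCat.ofHom φ = q.shortComplexKer.f ≫ ModuleCat.ofHom ψ := by
    ext z
    exact (h z).symm
  have : Abelian.Ext.mk₀ (ModuleCat.ofHom φ) = (Abelian.Ext.mk₀ q.shortComplexKer.f).comp
      (Abelian.Ext.mk₀ (ModuleCat.ofHom ψ)) (add_zero 0) := by
    rw [Abelian.Ext.mk₀_comp_mk₀, hφ]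
  rw [extOfHom, this]
  exact (LinearMap.shortExact_shortComplexKer hq).extClass_comp_assoc _

/-- Ext¹(F, N) vanishes, so the connecting map from Hom(ker q, N) is onto. -/
lemma extOfHom_surjective [Module.Projective R F] :
    Function.Surjective (extOfHom hq (N := N)) := by
  intro χ
  have : Projective q.shortComplexKer.X₂ :=
    inferInstanceAs (Projective (ModuleCat.of R F))
  obtain ⟨x, hx⟩ := precomp_extClass_surjective_of_projective_X₂ (ModuleCat.of R N)
    (LinearMap.shortExact_shortComplexKer hq) 0 χ
  refine ⟨(Abelian.Ext.homEquiv₀ x).hom, ?_⟩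
  rw [← hx]
  simp [extOfHom]

end Ext

/-! ### Pigeonhole on middle terms. -/

section Main

variable {R : Type u} [CommRing R] [IsLocalRing R] [IsNoetherianRing R]
  {M N F : Type u} [AddCommGroup M] [Module R M] [AddCommGroup N] [Module R N]
  [AddCommGroup F] [Module R F] [Module.Finite R F] [Module.Finite R N]

/-- If there are `h` isomorphism classes of possible middle terms, then any product of `h`
elements of the maximal ideal trivializes every extension. -/
lemma exists_extension_list_prod_smul {q : F →ₗ[R] M} (φ : LinearMap.ker q →ₗ[R] N)
    {C : Set (Quotient (isIsomorphicSetoid (ModuleCat.{u} R)))} (hC : C.Finite)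
    (hmem : ∀ r : R, (Quotient.mk _ (ModuleCat.of R (Pushout q (r • φ))) :
      Quotient (isIsomorphicSetoid (ModuleCat.{u} R))) ∈ C)
    (rs : List R) (hlen : rs.length = C.ncard) (hrs : ∀ r ∈ rs, r ∈ maximalIdeal R) :
    ∃ ψ : F →ₗ[R] N, ∀ z : LinearMap.ker q, ψ z = (rs.prod • φ) z := by
  let f : Fin (C.ncard + 1) → Quotient (isIsomorphicSetoid (ModuleCat.{u} R)) := fun j =>
    Quotient.mk _ (ModuleCat.of R (Pushout q ((rs.take j).prod • φ)))
  obtain ⟨a, b, hab, heq⟩ : ∃ a b : Fin (C.ncard + 1), a < b ∧ f a = f b := by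
    by_contra! hne
    have hinj : Function.Injective f := fun a b hab => by
      rcases lt_trichotomy a b with h | h | h
      · exact (hne a b h hab).elim
      · exact h
      · exact (hne b a h hab.symm).elim
    have h1 := Set.ncard_le_ncard (Set.range_subset_iff.mpr fun j => hmem (rs.take j).prod :
      Set.range f ⊆ C) hC
    rw [← Set.image_univ, Set.ncard_image_of_injective _ hinj, Set.ncard_univ] at h1
    simp at h1
  obtain ⟨e⟩ := Quotient.exact heq
  have hab' : (a : ℕ) < b := hab
  have hsplit : rs.take b = rs.take a ++ (rs.take b).drop a := by
    conv_lhs => rw [← List.take_append_drop a (rs.take b), List.take_take, min_eq_left hab'.le]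
  have hsmul : (rs.take b).prod • φ = ((rs.take b).drop a).prod • (rs.take a).prod • φ := by
    conv_lhs => rw [hsplit]
    rw [List.prod_append, mul_comm, mul_smul]
  have hr : ((rs.take b).drop a).prod ∈ maximalIdeal R := by
    obtain ⟨x, l, hxl⟩ : ∃ x l, (rs.take b).drop a = x :: l := by
      refine List.exists_cons_of_ne_nil fun h0 => ?_
      have := congrArg List.length h0
      simp only [List.length_drop, List.length_take, hlen, List.length_nil] at this
      omega
    rw [hxl, List.prod_cons]
    refine Ideal.mul_mem_right _ _ (hrs x (List.mem_of_mem_take (i := b)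
      (List.mem_of_mem_drop (i := a) ?_)))
    rw [hxl]
    exact List.mem_cons_self
  have e' : Pushout q ((rs.take a).prod • φ) ≃ₗ[R]
      Pushout q (((rs.take b).drop a).prod • (rs.take a).prod • φ) := by
    rw [← hsmul]
    exact e.toLinearEquiv
  obtain ⟨ψ, hψ⟩ := exists_extension_of_pushout_equiv q _ hr e'
  -- `ψ` extends the multiple of `φ` by the first `a` factors; the remaining ones are multiplied in.
  refine ⟨(rs.drop a).prod • ψ, fun z => ?_⟩
  rw [LinearMap.smul_apply, hψ, ← LinearMap.smul_apply, smul_smul, mul_comm,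
    ← List.prod_append, List.take_append_drop]

end Main

end LocalCM

theorem mainTheorem1 (R : Type u) [CommRing R] [IsLocalRing R] [IsNoetherianRing R]
    (M N : Type u) [AddCommGroup M] [Module R M] [AddCommGroup N] [Module R N]
    (hM : LocalCM.IsMCM R M) (hN : LocalCM.IsMCM R N)
    (m n : ℝ) (hm : LocalCM.HasMultiplicity R M m) (hn : LocalCM.HasMultiplicity R N n)
    (hfin : (LocalCM.mcmIsoClasses R (m + n)).Finite)
    (h : ℕ) (hh : (LocalCM.mcmIsoClasses R (m + n)).ncard = h) :
    (∀ r ∈ IsLocalRing.maximalIdeal R ^ h, ∀ χ : LocalCM.Ext1 R M N, r • χ = 0) ∧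
      IsFiniteLength R (LocalCM.Ext1 R M N) := by
  have := hM.finite
  have := hN.finite
  have hkill : ∀ r ∈ IsLocalRing.maximalIdeal R ^ h, ∀ χ : LocalCM.Ext1 R M N, r • χ = 0 := by
    intro r hr χ
    obtain ⟨t, q, hq⟩ := Module.Finite.exists_fin' R M
    obtain ⟨φ, rfl⟩ := LocalCM.extOfHom_surjective (N := N) hq χ
    -- The kernel of `toSpanSingleton` is the annihilator of the class.
    have hle := LocalCM.pow_le_of_forall_list_prod_mem (IsLocalRing.maximalIdeal R)
      (LinearMap.ker (LinearMap.toSpanSingleton R _ (LocalCM.extOfHom hq φ))) h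
      fun rs hlen hrs => by
        obtain ⟨ψ, hψ⟩ := LocalCM.exists_extension_list_prod_smul φ hfin
          (fun r => ⟨ModuleCat.of R (LocalCM.Pushout q (r • φ)),
            LocalCM.IsMCM.of_exact _ _ (LocalCM.pushoutInl_injective q _)
              (LocalCM.pushoutProj_surjective q _ hq) (LocalCM.pushout_exact q _) hN hM,
            LocalCM.HasMultiplicity.of_exact _ _ (LocalCM.pushoutInl_injective q _)
              (LocalCM.pushoutProj_surjective q _ hq) (LocalCM.pushout_exact q _) hm hn,
            rfl⟩) rs (hlen.trans hh.symm) hrs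
        rw [LinearMap.mem_ker, LinearMap.toSpanSingleton_apply, ← LocalCM.extOfHom_smul]
        exact LocalCM.extOfHom_eq_zero hq _ ψ hψ
    exact hle hr
  have hExt : Module.Finite R (LocalCM.Ext1 R M N) :=
    ModuleCat.finite_ext R (ModuleCat.of R M) (ModuleCat.of R N) 1
  exact ⟨hkill, LocalCM.isFiniteLength_of_pow_smul_eq_zero h hkill⟩
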